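/- Let $A\in\mathbb R^{n\times n}$, $B\in\mathbb R^{n\times M}$, $C\in\mathbb R^{M\times n}$, $C_0\in\mathbb R^{n_0\times n}$, and put $G(s)=C(sI-A)^{-1}B$, $G_0(s)=C_0(sI-A)^{-1}B$. A real polynomial is called stable if all its complex roots have negative real part. Assume: - $G(s)$ has full rank $M$ as a rational matrix, and $\xi_m(s)$ is a modified left interactor matrix of $G(s)$ with high-frequency gain matrix $K_p$; that is, $\xi_m(s)$ is a lower triangular $M\times M$ real polynomial matrix whose diagonal entries are monic stable polynomials of positive degree, and $K_p=\lim_{s\to\infty}\xi_m(s)G(s)$ is finite and nonsingular; - $(A,C_0)$ is observable and $\operatorname{rank}C_0=n_0$; - $\Lambda(s)$ is a monic stable real polynomial of degree $n-n_0$; - $Z(s),P(s)$ ($M\times M$) and $Z_0(s)$ ($n_0\times M$) are real polynomial matrices with $\det P(s)\not\equiv 0$, $G(s)=Z(s)P^{-1}(s)$ and $G_0(s)=Z_0(s)P^{-1}(s)$. Let $A_1(s)=[I_M,sI_M,\dots,s^{n-n_0-1}I_M]^{\rm T}$ and $A_2(s)=[I_{n_0},sI_{n_0},\dots,s^{n-n_0-1}I_{n_0}]^{\rm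 T}$. Then there exist constant matrices $\Theta_1^*\in\mathbb R^{M(n-n_0)\times M}$, $\Theta_2^*\in\mathbb R^{n_0(n-n_0)\times M}$, $\Theta_{20}^*\in\mathbb R^{n_0\times M}$ and $\Theta_3^*\in\mathbb R^{M\times M}$ such that, as an identity of polynomial matrices, $$\Theta_1^{*\rm T}A_1(s)P(s)+\big(\Theta_2^{*\rm T}A_2(s)+\Theta_{20}^{*\rm T}\Lambda(s)\big)Z_0(s)=\Lambda(s)\big(P(s)-\Theta_3^*K_p\,\xi_m(s)Z(s)\big).$$ -/

import Mathlib

open scoped Polynomial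

namespace PartialStateMRAC

/-- A real polynomial is stable if all its complex roots lie in the open left half-plane. -/
def Stable (p : ℝ[X]) : Prop :=
  ∀ z : ℂ, Polynomial.aeval z p = 0 → z.re < 0

/-- A constant real matrix, as a polynomial matrix. -/
noncomputable def constPoly {ι κ : Type*} (K : Matrix ι κ ℝ) : Matrix ι κ ℝ[X] :=
  K.map Polynomial.C

/-- A polynomial matrix, as a matrix of rational functions. -/
noncomputable def toRat {ι κ : Type*} (Q : Matrix ι κ ℝ[X]) : Matrix ι κ (RatFunc ℝ) :=
  Q.map (algebraMap ℝ[X] (RatFunc ℝ))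

/-- The transfer matrix `C (sI - A)⁻¹ B` as a matrix of rational functions.
`Matrix.charmatrix A` is the polynomial matrix `sI - A`; its determinant is monic, so it is
invertible over the field of rational functions. -/
noncomputable def transferMatrix {n M p : ℕ} (A : Matrix (Fin n) (Fin n) ℝ)
    (B : Matrix (Fin n) (Fin M) ℝ) (C : Matrix (Fin p) (Fin n) ℝ) :
    Matrix (Fin p) (Fin M) (RatFunc ℝ) :=
  toRat (constPoly C) * (toRat (Matrix.charmatrix A))⁻¹ * toRat (constPoly B)

/-- `(A, C)` is observable: the stacked matrix with blocks `C, CA, …, CA^(n-1)` has rank `n`. -/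
def Observable {n p : ℕ} (A : Matrix (Fin n) (Fin n) ℝ) (C : Matrix (Fin p) (Fin n) ℝ) : Prop :=
  (Matrix.of fun (k : Fin n × Fin p) (j : Fin n) => (C * A ^ (k.1 : ℕ)) k.2 j).rank = n

/-- `ξ` is a modified left interactor matrix of the square rational matrix `G`, and `Kp` is the
corresponding high-frequency gain matrix `lim_{s → ∞} ξ(s) G(s)`. The limit is taken entrywise
along real `s → +∞`; as the entries are rational functions, a finite limit there is the same as
a finite limit along complex `s → ∞`. -/
structure IsModifiedLeftInteractor {M : ℕ} (G : Matrix (Fin M) (Fin M) (RatFunc ℝ))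
    (ξ : Matrix (Fin M) (Fin M) ℝ[X]) (Kp : Matrix (Fin M) (Fin M) ℝ) : Prop where
  lowerTriangular : ∀ i j, i < j → ξ i j = 0
  diag_monic : ∀ i, (ξ i i).Monic
  diag_stable : ∀ i, Stable (ξ i i)
  diag_degree_pos : ∀ i, 0 < (ξ i i).natDegree
  tendsto_gain : ∀ i j, Filter.Tendsto
    (fun s : ℝ => RatFunc.eval (RingHom.id ℝ) s ((toRat ξ * G) i j)) Filter.atTop (nhds (Kp i j))
  gain_nonsingular : IsUnit Kp.det

/-- `G = Z P⁻¹` for polynomial matrices `Z` and `P`, with `P` nonsingular. -/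
def IsRightFraction {p M : ℕ} (G : Matrix (Fin p) (Fin M) (RatFunc ℝ))
    (Z : Matrix (Fin p) (Fin M) ℝ[X]) (P : Matrix (Fin M) (Fin M) ℝ[X]) : Prop :=
  P.det ≠ 0 ∧ G = toRat Z * (toRat P)⁻¹

/-- The stacked polynomial matrix `[I_q, s I_q, …, s^(d-1) I_q]ᵀ`, with `d` blocks of size `q`;
row `(k, i)` is row `i` of block `k`. -/
noncomputable def powerStack (d q : ℕ) : Matrix (Fin d × Fin q) (Fin q) ℝ[X] :=
  Matrix.of fun k j => if k.2 = j then Polynomial.X ^ (k.1 : ℕ) else 0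

end PartialStateMRAC

open PartialStateMRAC

/-! The identity is state feedback realised through a reduced-order observer. Right division of `ξ
C` by `sI - A` leaves a constant remainder `R`. The limit defining `Kp` forces the polynomial part
of `ξ G` to be `Kp`, so `Kp⁻¹ ξ G = I + K (sI - A)⁻¹ B` with `K = Kp⁻¹ R`
(`IsModifiedLeftInteractor.exists_mul_eq`).

Let `d = n - n₀`. By observability the rows of `C₀ A ^ j`, `j ≤ d`, span the whole space. This
yields `D`, `N` of degree below `d` and a constant `L` with `(D + Λ L) C₀ + Λ K = N (sI - A)`
(`Observable.exists_observer_identity`). Multiplying on the right by `(sI - A)⁻¹ B` gives `-N B + (D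
+ Λ L) G₀ = Λ (I - Kp⁻¹ ξ G)`, and multiplying by `P` clears the fractions. The parameters are the
coefficients of `-N B` and `D`, together with `L`. -/

namespace PartialStateMRAC

open Polynomial Matrix

/-! ### Krylov subspaces and the observability index -/

section Krylov

variable {K E : Type*} [Field K] [AddCommGroup E] [Module K E]

/-- The span of `U, f U, …, f ^ k U`. -/
def krylov (f : E →ₗ[K] E) (U : Submodule K E) : ℕ → Submodule K E
  | 0 => U
  | k + 1 => U ⊔ (krylov f U k).map f

theorem krylov_le_succ (f : E →ₗ[K] E) (U : Submodule K E) (k : ℕ) :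
    krylov f U k ≤ krylov f U (k + 1) := by
  induction k with
  | zero => exact le_sup_left
  | succ k ih => exact sup_le_sup_left (Submodule.map_mono ih) U

theorem le_krylov (f : E →ₗ[K] E) (U : Submodule K E) (k : ℕ) : U ≤ krylov f U k := by
  cases k with
  | zero => exact le_rfl
  | succ k => exact le_sup_left

/-- If `U` generates the space under `f`, every Krylov step gains a dimension until the whole
space is reached. -/
theorem krylov_eq_top_or_le_finrank [FiniteDimensional K E] (f : E →ₗ[K] E) (U : Submodule K E)
    (hU : ∀ W : Submodule K E, U ≤ W → W.map f ≤ W → W = ⊤) (k : ℕ) :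
    krylov f U k = ⊤ ∨ Module.finrank K U + k ≤ Module.finrank K (krylov f U k) := by
  induction k with
  | zero => exact Or.inr le_rfl
  | succ k ih =>
    rcases ih with h | h
    · exact Or.inl (top_le_iff.mp (h ▸ krylov_le_succ f U k))
    · rcases (krylov_le_succ f U k).eq_or_lt with he | hlt
      · left
        -- A chain that stalls at step `k` has `krylov f U k` invariant under `f`.
        rw [← he]
        refine hU _ (le_krylov f U k) ?_
        conv_rhs => rw [he]
        exact le_sup_right
      · right
        have := Submodule.finrank_lt_finrank_of_lt hlt
        omega

theorem krylov_eq_top [FiniteDimensional K E] (f : E →ₗ[K] E) (U : Submodule K E)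
    (hU : ∀ W : Submodule K E, U ≤ W → W.map f ≤ W → W = ⊤) :
    krylov f U (Module.finrank K E - Module.finrank K U) = ⊤ := by
  rcases krylov_eq_top_or_le_finrank f U hU (Module.finrank K E - Module.finrank K U) with h | h
  · exact h
  · apply Submodule.eq_top_of_finrank_eq
    have h1 := Submodule.finrank_le U
    have h2 := Submodule.finrank_le (krylov f U (Module.finrank K E - Module.finrank K U))
    omega

end Krylov

theorem exists_eq_sum_vecMul_of_mem_krylov {n p : ℕ} (A : Matrix (Fin n) (Fin n) ℝ)
    (C : Matrix (Fin p) (Fin n) ℝ) (k : ℕ) (v : Fin n → ℝ)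
    (hv : v ∈ krylov A.vecMulLinear (LinearMap.range C.vecMulLinear) k) :
    ∃ D : ℕ → Fin p → ℝ, v = ∑ j ∈ Finset.range (k + 1), D j ᵥ* (C * A ^ j) := by
  induction k generalizing v with
  | zero =>
    obtain ⟨d, rfl⟩ := hv
    exact ⟨fun _ => d, by simp⟩
  | succ k ih =>
    obtain ⟨_, ⟨d, rfl⟩, _, ⟨w, hw, rfl⟩, rfl⟩ := Submodule.mem_sup.mp hv
    obtain ⟨D, rfl⟩ := ih w hw
    -- Applying `A` raises each power by one, so the old coefficients shift and `d` fills place 0.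
    refine ⟨fun j => Nat.casesOn j d D, ?_⟩
    rw [map_sum, Finset.sum_range_succ' _ (k + 1), add_comm]
    simp [pow_succ, Matrix.mul_assoc]

/-- The observability index of `(A, C)` is at most `n - rank C + 1`. -/
theorem Observable.exists_eq_sum {n p q : ℕ} {A : Matrix (Fin n) (Fin n) ℝ}
    {C : Matrix (Fin p) (Fin n) ℝ} (hobs : Observable A C) (W : Matrix (Fin q) (Fin n) ℝ) :
    ∃ D : ℕ → Matrix (Fin q) (Fin p) ℝ,
      W = ∑ j ∈ Finset.range (n - C.rank + 1), D j * (C * A ^ j) := by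
  have hrange : Module.finrank ℝ (LinearMap.range C.vecMulLinear) = C.rank := by
    rw [Matrix.rank_eq_finrank_span_row, range_vecMulLinear]
  have hinv : ∀ V : Submodule ℝ (Fin n → ℝ), LinearMap.range C.vecMulLinear ≤ V →
      V.map A.vecMulLinear ≤ V → V = ⊤ := by
    intro V hCV hAV
    have hrow : ∀ (k : ℕ) (i : Fin p), (C * A ^ k) i ∈ V := by
      intro k i
      induction k with
      | zero =>
        refine hCV ⟨Pi.single i 1, ?_⟩
        simp [Matrix.row]
      | succ k ih =>
        have h := hAV (Submodule.mem_map_of_mem ih)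
        rwa [Matrix.vecMulLinear_apply, ← Matrix.mul_apply_eq_vecMul, Matrix.mul_assoc,
          ← pow_succ] at h
    have hspan := hobs
    rw [Observable, Matrix.rank_eq_finrank_span_row] at hspan
    have htop := Submodule.eq_top_of_finrank_eq (hspan.trans (by simp))
    rw [← top_le_iff, ← htop, Submodule.span_le]
    rintro _ ⟨⟨k, i⟩, rfl⟩
    exact hrow k i
  have htop := krylov_eq_top _ _ hinv
  rw [hrange, Module.finrank_fin_fun] at htop
  choose D hD using fun i => exists_eq_sum_vecMul_of_mem_krylov A C (n - C.rank) (W i)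
    (htop ▸ Submodule.mem_top)
  refine ⟨fun j => Matrix.of fun i => D i j, ?_⟩
  ext i l
  rw [hD i, Matrix.sum_apply, Finset.sum_apply]
  rfl

/-! ### Polynomial matrices and their rational images -/

section PolynomialMatrices

variable {ι κ μ : Type*}

@[simp]
theorem constPoly_apply (K : Matrix ι κ ℝ) (i : ι) (j : κ) :
    constPoly K i j = Polynomial.C (K i j) := rfl

theorem constPoly_mul [Fintype κ] (K : Matrix ι κ ℝ) (L : Matrix κ μ ℝ) :
    constPoly (K * L) = constPoly K * constPoly L :=
  Matrix.map_mul

theorem constPoly_sum {τ : Type*} (s : Finset τ) (K : τ → Matrix ι κ ℝ) :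
    constPoly (∑ t ∈ s, K t) = ∑ t ∈ s, constPoly (K t) := by
  ext1 i j
  simp [Matrix.sum_apply]

theorem constPoly_one [DecidableEq ι] : constPoly (1 : Matrix ι ι ℝ) = 1 := by
  simp [constPoly]

theorem toRat_mul [Fintype κ] (Q : Matrix ι κ ℝ[X]) (R : Matrix κ μ ℝ[X]) :
    toRat (Q * R) = toRat Q * toRat R :=
  Matrix.map_mul

theorem toRat_add (Q R : Matrix ι κ ℝ[X]) : toRat (Q + R) = toRat Q + toRat R := by
  ext1 i j
  simp [toRat]

theorem toRat_sub (Q R : Matrix ι κ ℝ[X]) : toRat (Q - R) = toRat Q - toRat R := by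
  ext1 i j
  simp [toRat]

theorem toRat_neg (Q : Matrix ι κ ℝ[X]) : toRat (-Q) = -toRat Q := by
  ext1 i j
  simp [toRat]

theorem toRat_one [DecidableEq ι] : toRat (1 : Matrix ι ι ℝ[X]) = 1 := by
  simp [toRat]

theorem toRat_smul (p : ℝ[X]) (Q : Matrix ι κ ℝ[X]) :
    toRat (p • Q) = algebraMap ℝ[X] (RatFunc ℝ) p • toRat Q := by
  ext1 i j
  simp [toRat]

theorem toRat_injective :
    Function.Injective (toRat : Matrix ι κ ℝ[X] → Matrix ι κ (RatFunc ℝ)) :=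
  Matrix.map_injective (RatFunc.algebraMap_injective ℝ)

theorem isUnit_det_toRat [Fintype ι] [DecidableEq ι] {Q : Matrix ι ι ℝ[X]} (hQ : Q.det ≠ 0) :
    IsUnit (toRat Q).det := by
  have h : (toRat Q).det = algebraMap ℝ[X] (RatFunc ℝ) Q.det :=
    (RingHom.map_det (algebraMap ℝ[X] (RatFunc ℝ)) Q).symm
  rw [h, isUnit_iff_ne_zero]
  exact RatFunc.algebraMap_ne_zero hQ

theorem toRat_inv [Fintype ι] [DecidableEq ι] {Q : Matrix ι ι ℝ[X]} (hQ : Q.det ≠ 0) :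
    (toRat Q)⁻¹ = (algebraMap ℝ[X] (RatFunc ℝ) Q.det)⁻¹ • toRat Q.adjugate := by
  apply Matrix.inv_eq_right_inv
  rw [Matrix.mul_smul, ← toRat_mul, Matrix.mul_adjugate, toRat_smul, toRat_one, smul_smul,
    inv_mul_cancel₀ (RatFunc.algebraMap_ne_zero hQ), one_smul]

theorem exists_constPoly_mul_powerStack {d q : ℕ} (Q : Matrix ι (Fin q) ℝ[X])
    (hQ : ∀ i j, Q i j ∈ degreeLT ℝ d) :
    ∃ Θ : Matrix (Fin d × Fin q) ι ℝ, constPoly Θ.transpose * powerStack d q = Q := by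
  refine ⟨Matrix.of fun k i => (Q i k.2).coeff k.1, ?_⟩
  ext1 i j
  simp only [Matrix.mul_apply, Fintype.sum_prod_type, powerStack, Matrix.of_apply, mul_ite,
    mul_zero, Finset.sum_ite_eq', Finset.mem_univ, if_true, constPoly_apply,
    Matrix.transpose_apply]
  rw [Fin.sum_univ_eq_sum_range (fun k => Polynomial.C ((Q i j).coeff k) * Polynomial.X ^ k) d]
  ext m
  rw [Polynomial.finsetSum_coeff]
  simp only [Polynomial.coeff_C_mul_X_pow, Finset.sum_ite_eq, Finset.mem_range]
  split_ifs with hm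
  · rfl
  · exact (Polynomial.coeff_eq_zero_of_degree_lt
      ((Polynomial.mem_degreeLT.mp (hQ i j)).trans_le (by exact_mod_cast not_lt.mp hm))).symm

theorem exists_eq_sum_X_pow_smul_constPoly [Fintype ι] [Fintype κ] (Q : Matrix ι κ ℝ[X]) :
    ∃ (d : ℕ) (w : ℕ → Matrix ι κ ℝ),
      Q = ∑ k ∈ Finset.range d, (Polynomial.X ^ k : ℝ[X]) • constPoly (w k) := by
  refine ⟨(Finset.univ.sup fun p : ι × κ => (Q p.1 p.2).natDegree) + 1,
    fun k => Q.map fun p => p.coeff k, ?_⟩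
  ext1 i j
  rw [Matrix.sum_apply, Polynomial.as_sum_range_C_mul_X_pow' (Q i j) (Nat.lt_succ_of_le
    (Finset.le_sup (f := fun p : ι × κ => (Q p.1 p.2).natDegree) (Finset.mem_univ (i, j))))]
  refine Finset.sum_congr rfl fun k _ => ?_
  exact mul_comm _ _

end PolynomialMatrices

/-! ### Right division by `sI - A` and strict properness -/

section Division

variable {ι : Type*} {n : ℕ}

theorem charmatrix_eq (A : Matrix (Fin n) (Fin n) ℝ) :
    A.charmatrix = (Polynomial.X : ℝ[X]) • (1 : Matrix (Fin n) (Fin n) ℝ[X]) - constPoly A := by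
  ext1 i j
  simp [Matrix.charmatrix, constPoly, Matrix.smul_one_eq_diagonal]

/-- Modulo right multiples of `sI - A`, a factor `s` acts on a constant matrix as right
multiplication by `A`. The degree bound on the quotient later limits the order of the observer. -/
theorem exists_X_pow_smul_constPoly_eq (A : Matrix (Fin n) (Fin n) ℝ) (w : Matrix ι (Fin n) ℝ)
    (k : ℕ) : ∃ N : Matrix ι (Fin n) ℝ[X], (∀ i j, N i j ∈ degreeLT ℝ k) ∧
      (Polynomial.X ^ k : ℝ[X]) • constPoly w = N * A.charmatrix + constPoly (w * A ^ k) := by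
  induction k with
  | zero => exact ⟨0, fun i j => Submodule.zero_mem _, by simp⟩
  | succ k ih =>
    obtain ⟨N, hN, h⟩ := ih
    refine ⟨(Polynomial.X : ℝ[X]) • N + constPoly (w * A ^ k), fun i j => ?_, ?_⟩
    · rw [Matrix.add_apply, Matrix.smul_apply, constPoly_apply, smul_eq_mul]
      refine Submodule.add_mem _ ?_ ?_
      · have := Polynomial.mem_degreeLT.mp (hN i j)
        rw [Polynomial.mem_degreeLT, Polynomial.degree_lt_iff_coeff_zero]
        rw [Polynomial.degree_lt_iff_coeff_zero] at this
        intro m hm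
        obtain ⟨m, rfl⟩ : ∃ l, m = l + 1 := ⟨m - 1, by omega⟩
        rw [Polynomial.coeff_X_mul]
        exact this m (by omega)
      · rw [Polynomial.mem_degreeLT]
        exact Polynomial.degree_C_le.trans_lt (by exact_mod_cast Nat.succ_pos k)
    · have hc : (Polynomial.X : ℝ[X]) • constPoly (w * A ^ k)
          = constPoly (w * A ^ k) * A.charmatrix + constPoly (w * A ^ (k + 1)) := by
        rw [charmatrix_eq, Matrix.mul_sub, Matrix.mul_smul, Matrix.mul_one, ← constPoly_mul,
          Matrix.mul_assoc, ← pow_succ, sub_add_cancel]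
      rw [pow_succ', mul_smul, h, smul_add, hc, Matrix.add_mul, Matrix.smul_mul, add_assoc]

/-- Right division of a polynomial matrix by `sI - A`. -/
theorem exists_sum_X_pow_smul_constPoly_eq (A : Matrix (Fin n) (Fin n) ℝ)
    (w : ℕ → Matrix ι (Fin n) ℝ) (d : ℕ) :
    ∃ N : Matrix ι (Fin n) ℝ[X], (∀ i j, N i j ∈ degreeLT ℝ d) ∧
      ∑ k ∈ Finset.range (d + 1), (Polynomial.X ^ k : ℝ[X]) • constPoly (w k)
        = N * A.charmatrix + constPoly (∑ k ∈ Finset.range (d + 1), w k * A ^ k) := by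
  choose N hN h using fun k => exists_X_pow_smul_constPoly_eq A (w k) k
  refine ⟨∑ k ∈ Finset.range (d + 1), N k, fun i j => ?_, ?_⟩
  · rw [Matrix.sum_apply]
    refine Submodule.sum_mem _ fun k hk => ?_
    exact Polynomial.degreeLT_mono (Nat.lt_succ_iff.mp (Finset.mem_range.mp hk)) (hN k i j)
  · rw [Finset.sum_congr rfl fun k _ => h k, Finset.sum_add_distrib, Matrix.sum_mul,
      constPoly_sum]

theorem exists_eq_mul_charmatrix_add [Fintype ι] (A : Matrix (Fin n) (Fin n) ℝ)
    (Q : Matrix ι (Fin n) ℝ[X]) :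
    ∃ (N : Matrix ι (Fin n) ℝ[X]) (R : Matrix ι (Fin n) ℝ),
      Q = N * A.charmatrix + constPoly R := by
  obtain ⟨d, w, rfl⟩ := exists_eq_sum_X_pow_smul_constPoly Q
  choose N _ h using fun k => exists_X_pow_smul_constPoly_eq A (w k) k
  refine ⟨∑ k ∈ Finset.range d, N k, ∑ k ∈ Finset.range d, w k * A ^ k, ?_⟩
  rw [Finset.sum_congr rfl fun k _ => h k, Finset.sum_add_distrib, Matrix.sum_mul, constPoly_sum]

/-- Cofactors are minors of size `n - 1` whose entries have degree at most one. -/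
theorem adjugate_charmatrix_mem_degreeLT (A : Matrix (Fin n) (Fin n) ℝ) (i j : Fin n) :
    A.charmatrix.adjugate i j ∈ degreeLT ℝ n := by
  cases n with
  | zero => exact i.elim0
  | succ n =>
    rw [Matrix.adjugate_fin_succ_eq_det_submatrix]
    have hs : A.charmatrix.submatrix j.succAbove i.succAbove
        = (Polynomial.X : ℝ[X]) • ((1 : Matrix (Fin (n + 1)) (Fin (n + 1)) ℝ).submatrix
            j.succAbove i.succAbove).map Polynomial.C
          + ((-A).submatrix j.succAbove i.succAbove).map Polynomial.C := by
      ext1 a b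
      rw [charmatrix_eq]
      by_cases h : j.succAbove a = i.succAbove b <;>
        simp [h, sub_eq_add_neg, Matrix.one_apply]
    have hdeg := Polynomial.natDegree_det_X_add_C_le
      ((1 : Matrix (Fin (n + 1)) (Fin (n + 1)) ℝ).submatrix j.succAbove i.succAbove)
      ((-A).submatrix j.succAbove i.succAbove)
    rw [← hs, Fintype.card_fin] at hdeg
    have hpow : ((-1 : ℝ[X]) ^ ((j : ℕ) + (i : ℕ)))
        = Polynomial.C ((-1 : ℝ) ^ ((j : ℕ) + (i : ℕ))) := by simp
    rw [hpow, ← Polynomial.smul_eq_C_mul]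
    refine Submodule.smul_mem _ _ (Polynomial.mem_degreeLT.mpr ?_)
    exact (Polynomial.degree_le_of_natDegree_le hdeg).trans_lt
      (by exact_mod_cast Nat.lt_succ_self n)

theorem det_charmatrix_ne_zero (A : Matrix (Fin n) (Fin n) ℝ) : A.charmatrix.det ≠ 0 :=
  A.charpoly_monic.ne_zero

/-- Entries of `C (sI - A)⁻¹ B` are strictly proper with denominator `det (sI - A)`. -/
theorem exists_transferMatrix_apply_eq_div {M p : ℕ} (A : Matrix (Fin n) (Fin n) ℝ)
    (B : Matrix (Fin n) (Fin M) ℝ) (C : Matrix (Fin p) (Fin n) ℝ) (i : Fin p) (j : Fin M) :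
    ∃ r : ℝ[X], r.degree < A.charpoly.degree ∧ transferMatrix A B C i j
      = algebraMap ℝ[X] (RatFunc ℝ) r / algebraMap ℝ[X] (RatFunc ℝ) A.charpoly := by
  refine ⟨(constPoly C * A.charmatrix.adjugate * constPoly B) i j, ?_, ?_⟩
  · rw [Polynomial.degree_eq_natDegree A.charpoly_monic.ne_zero, A.charpoly_natDegree_eq_dim,
      Fintype.card_fin, ← Polynomial.mem_degreeLT]
    simp only [Matrix.mul_apply, constPoly_apply, Finset.sum_mul]
    refine Submodule.sum_mem _ fun k _ => Submodule.sum_mem _ fun l _ => ?_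
    rw [mul_comm, ← Polynomial.smul_eq_C_mul, ← Polynomial.smul_eq_C_mul]
    exact Submodule.smul_mem _ _ (Submodule.smul_mem _ _ (adjugate_charmatrix_mem_degreeLT A l k))
  · rw [transferMatrix, toRat_inv (det_charmatrix_ne_zero A), Matrix.mul_smul, Matrix.smul_mul,
      Matrix.smul_apply, ← toRat_mul, ← toRat_mul, smul_eq_mul, div_eq_inv_mul]
    rfl

end Division

/-! ### Behaviour at infinity and the high-frequency gain -/

/-- `RatFunc.eval` uses the reduced fraction, whose denominator divides `q` and hence is nonzero at
`s`. -/
theorem eval_ratFunc_div {p q : ℝ[X]} {s : ℝ} (hs : q.eval s ≠ 0) :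
    RatFunc.eval (RingHom.id ℝ) s
      (algebraMap ℝ[X] (RatFunc ℝ) p / algebraMap ℝ[X] (RatFunc ℝ) q) = p.eval s / q.eval s := by
  have hq : q ≠ 0 := by
    rintro rfl
    simp at hs
  set x : RatFunc ℝ := algebraMap ℝ[X] (RatFunc ℝ) p / algebraMap ℝ[X] (RatFunc ℝ) q with hx
  have hnum : x.num * q = p * x.denom := (RatFunc.num_mul_eq_mul_denom_iff hq).mpr hx
  obtain ⟨c, hc⟩ := (RatFunc.denom_dvd hq).mpr ⟨p, hx⟩
  have hd : x.denom.eval s ≠ 0 := by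
    intro h
    rw [hc, Polynomial.eval_mul, h, zero_mul] at hs
    exact hs rfl
  have hev := congrArg (Polynomial.eval s) hnum
  rw [Polynomial.eval_mul, Polynomial.eval_mul] at hev
  rw [RatFunc.eval, Polynomial.eval₂_id, Polynomial.eval₂_id, div_eq_div_iff hd hs, hev]

/-- The polynomial part of a rational function with a finite limit at infinity is that limit. -/
theorem eq_C_of_tendsto_eval {q r χ : ℝ[X]} (hr : r.degree < χ.degree) {c : ℝ}
    (h : Filter.Tendsto (fun s : ℝ => RatFunc.eval (RingHom.id ℝ) s
      (algebraMap ℝ[X] (RatFunc ℝ) q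
        + algebraMap ℝ[X] (RatFunc ℝ) r / algebraMap ℝ[X] (RatFunc ℝ) χ)) Filter.atTop (nhds c)) :
    q = Polynomial.C c := by
  have hχ : χ ≠ 0 := by
    rintro rfl
    simp at hr
  have h0 := Polynomial.div_tendsto_atTop_zero_of_degree_lt r χ hr
  have hq : Filter.Tendsto (fun s : ℝ => q.eval s) Filter.atTop (nhds c) := by
    have hsub := h.sub h0
    rw [sub_zero] at hsub
    refine hsub.congr' ?_
    filter_upwards [Polynomial.eventually_atTop_not_isRoot χ hχ] with s hs
    have hs' : χ.eval s ≠ 0 := hs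
    have hsum : algebraMap ℝ[X] (RatFunc ℝ) q
        + algebraMap ℝ[X] (RatFunc ℝ) r / algebraMap ℝ[X] (RatFunc ℝ) χ
        = algebraMap ℝ[X] (RatFunc ℝ) (q * χ + r) / algebraMap ℝ[X] (RatFunc ℝ) χ := by
      rw [map_add, map_mul, add_div, mul_div_cancel_right₀ _ (RatFunc.algebraMap_ne_zero hχ)]
    rw [hsum, eval_ratFunc_div hs', Polynomial.eval_add, Polynomial.eval_mul, add_div,
      mul_div_cancel_right₀ _ hs', add_sub_cancel_right]
  obtain ⟨hlead, hdeg⟩ := (Polynomial.tendsto_nhds_iff q).mp hq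
  rw [Polynomial.eq_C_of_degree_le_zero hdeg] at hlead ⊢
  rw [Polynomial.leadingCoeff_C] at hlead
  rw [hlead]

/-- `ξ G` differs from its limit `Kp` by a strictly proper matrix with the same `A` and `B`. -/
theorem IsModifiedLeftInteractor.exists_mul_eq {n M : ℕ} {A : Matrix (Fin n) (Fin n) ℝ}
    {B : Matrix (Fin n) (Fin M) ℝ} {C : Matrix (Fin M) (Fin n) ℝ}
    {ξ : Matrix (Fin M) (Fin M) ℝ[X]} {Kp : Matrix (Fin M) (Fin M) ℝ}
    (hξ : IsModifiedLeftInteractor (transferMatrix A B C) ξ Kp) :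
    ∃ R : Matrix (Fin M) (Fin n) ℝ,
      toRat ξ * transferMatrix A B C = toRat (constPoly Kp) + transferMatrix A B R := by
  obtain ⟨N, R, hNR⟩ := exists_eq_mul_charmatrix_add A (ξ * constPoly C)
  have hS := isUnit_det_toRat (det_charmatrix_ne_zero A)
  have hmul : toRat ξ * transferMatrix A B C
      = toRat (N * constPoly B) + transferMatrix A B R := by
    rw [transferMatrix, transferMatrix, ← Matrix.mul_assoc, ← Matrix.mul_assoc, ← toRat_mul, hNR,
      toRat_add, toRat_mul, Matrix.add_mul, Matrix.add_mul,
      Matrix.mul_nonsing_inv_cancel_right _ _ hS, toRat_mul]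
  have hconst : N * constPoly B = constPoly Kp := by
    ext1 i j
    obtain ⟨r, hr, hrR⟩ := exists_transferMatrix_apply_eq_div A B R i j
    refine eq_C_of_tendsto_eval hr ?_
    have h := hξ.tendsto_gain i j
    rw [hmul, Matrix.add_apply, hrR] at h
    exact h
  exact ⟨R, by rw [hmul, hconst]⟩

/-! ### Reduced-order observer -/

/-- The identity that a reduced-order observer of the state feedback `K` satisfies. -/
theorem Observable.exists_observer_identity {n p q : ℕ} {A : Matrix (Fin n) (Fin n) ℝ}
    {C : Matrix (Fin p) (Fin n) ℝ} (hobs : Observable A C) {Λ : ℝ[X]} (hΛ : Λ.Monic)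
    (hdeg : Λ.natDegree = n - C.rank) (K : Matrix (Fin q) (Fin n) ℝ) :
    ∃ (D : Matrix (Fin q) (Fin p) ℝ[X]) (L : Matrix (Fin q) (Fin p) ℝ)
      (N : Matrix (Fin q) (Fin n) ℝ[X]),
      (∀ i j, D i j ∈ degreeLT ℝ (n - C.rank)) ∧ (∀ i j, N i j ∈ degreeLT ℝ (n - C.rank)) ∧
      (D + Λ • constPoly L) * constPoly C + Λ • constPoly K = N * A.charmatrix := by
  set d := n - C.rank with hd
  -- `E` is chosen so that `∑ E k sᵏ C + Λ K` has zero remainder on right division by `sI - A`.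
  obtain ⟨E, hE⟩ := hobs.exists_eq_sum
    (-∑ k ∈ Finset.range (d + 1), (Λ.coeff k • K) * A ^ k)
  rw [← hd] at hE
  obtain ⟨N, hN, hdiv⟩ := exists_sum_X_pow_smul_constPoly_eq A
    (fun k => E k * C + Λ.coeff k • K) d
  -- Subtracting `Λ E d` removes the term of degree `d`, as `Λ` is monic of that degree; hence `L =
  -- E d`.
  refine ⟨∑ k ∈ Finset.range (d + 1), (Polynomial.X ^ k : ℝ[X]) • constPoly (E k)
    - Λ • constPoly (E d), E d, N, fun i j => ?_, hN, ?_⟩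
  · rw [Matrix.sub_apply, Matrix.sum_apply, Finset.sum_range_succ, Polynomial.mem_degreeLT,
      Polynomial.degree_lt_iff_coeff_zero]
    intro m hm
    simp only [Matrix.smul_apply, constPoly_apply, smul_eq_mul, Polynomial.coeff_sub,
      Polynomial.coeff_add, Polynomial.finsetSum_coeff, Polynomial.coeff_mul_C,
      Polynomial.coeff_X_pow]
    rw [Finset.sum_eq_zero fun k hk => by
      rw [if_neg (by have := Finset.mem_range.mp hk; omega), zero_mul], zero_add]
    rcases eq_or_lt_of_le hm with rfl | hlt
    · rw [if_pos rfl, ← hdeg, hΛ.coeff_natDegree, hdeg, sub_self]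
    · rw [if_neg hlt.ne', Polynomial.coeff_eq_zero_of_natDegree_lt (hdeg ▸ hlt), zero_mul,
        sub_self]
  · have hrem : ∑ k ∈ Finset.range (d + 1), (E k * C + Λ.coeff k • K) * A ^ k = 0 := by
      simp only [Matrix.add_mul, Finset.sum_add_distrib, Matrix.mul_assoc (E _)]
      rw [← hE, neg_add_cancel]
    have hΛK : Λ • constPoly K = ∑ k ∈ Finset.range (d + 1),
        (Polynomial.X ^ k : ℝ[X]) • constPoly (Λ.coeff k • K) := by
      ext1 i j
      rw [Matrix.sum_apply, Matrix.smul_apply, smul_eq_mul]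
      conv_lhs => rw [Λ.as_sum_range_C_mul_X_pow, hdeg, Finset.sum_mul]
      refine Finset.sum_congr rfl fun k _ => ?_
      simp only [Matrix.smul_apply, constPoly_apply, smul_eq_mul, map_mul]
      ring
    have hconst0 : constPoly (0 : Matrix (Fin q) (Fin n) ℝ) = 0 := by
      ext1 i j
      simp
    rw [hrem, hconst0, add_zero] at hdiv
    rw [sub_add_cancel, hΛK, ← hdiv, Matrix.sum_mul, ← Finset.sum_add_distrib]
    refine Finset.sum_congr rfl fun k _ => ?_
    rw [Matrix.smul_mul, ← constPoly_mul, ← smul_add]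
    congr 1
    ext1 i j
    simp

theorem transferMatrix_mul_left {n M p q : ℕ} (A : Matrix (Fin n) (Fin n) ℝ)
    (B : Matrix (Fin n) (Fin M) ℝ) (K : Matrix (Fin q) (Fin p) ℝ) (C : Matrix (Fin p) (Fin n) ℝ) :
    transferMatrix A B (K * C) = toRat (constPoly K) * transferMatrix A B C := by
  simp only [transferMatrix, constPoly_mul, toRat_mul, Matrix.mul_assoc]

end PartialStateMRAC

/-! ### The matching identity -/

theorem mainTheorem4 (n M n₀ : ℕ)
    (A : Matrix (Fin n) (Fin n) ℝ) (B : Matrix (Fin n) (Fin M) ℝ)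
    (C : Matrix (Fin M) (Fin n) ℝ) (C₀ : Matrix (Fin n₀) (Fin n) ℝ)
    (hG : (transferMatrix A B C).rank = M)
    (ξ : Matrix (Fin M) (Fin M) ℝ[X]) (Kp : Matrix (Fin M) (Fin M) ℝ)
    (hξ : IsModifiedLeftInteractor (transferMatrix A B C) ξ Kp)
    (hobs : Observable A C₀) (hC₀ : C₀.rank = n₀)
    (Λ : ℝ[X]) (hΛmonic : Λ.Monic) (hΛstable : Stable Λ) (hΛdeg : Λ.natDegree = n - n₀)
    (Z P : Matrix (Fin M) (Fin M) ℝ[X]) (Z₀ : Matrix (Fin n₀) (Fin M) ℝ[X])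
    (hZ : IsRightFraction (transferMatrix A B C) Z P)
    (hZ₀ : IsRightFraction (transferMatrix A B C₀) Z₀ P) :
    ∃ (Θ₁ : Matrix (Fin (n - n₀) × Fin M) (Fin M) ℝ)
      (Θ₂ : Matrix (Fin (n - n₀) × Fin n₀) (Fin M) ℝ)
      (Θ₂₀ : Matrix (Fin n₀) (Fin M) ℝ) (Θ₃ : Matrix (Fin M) (Fin M) ℝ),
      constPoly Θ₁.transpose * powerStack (n - n₀) M * P
          + (constPoly Θ₂.transpose * powerStack (n - n₀) n₀
              + Λ • constPoly Θ₂₀.transpose) * Z₀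
        = Λ • (P - constPoly Θ₃ * constPoly Kp * ξ * Z) := by
  obtain ⟨R, hR⟩ := hξ.exists_mul_eq
  obtain ⟨D, L, N, hD, hN, hobsid⟩ := hobs.exists_observer_identity hΛmonic
    (hΛdeg.trans (by rw [hC₀])) (Kp⁻¹ * R)
  rw [hC₀] at hD hN
  obtain ⟨Θ₁, hΘ₁⟩ := exists_constPoly_mul_powerStack (-(N * constPoly B)) (fun i j => by
    rw [Matrix.neg_apply, Matrix.mul_apply]
    refine Submodule.neg_mem _ (Submodule.sum_mem _ fun k _ => ?_)
    rw [constPoly_apply, mul_comm, ← Polynomial.smul_eq_C_mul]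
    exact Submodule.smul_mem _ _ (hN i k))
  obtain ⟨Θ₂, hΘ₂⟩ := exists_constPoly_mul_powerStack D hD
  -- The identity needs `Θ₃ Kp = Kp⁻¹`, whence the squared inverse.
  refine ⟨Θ₁, Θ₂, L.transpose, Kp⁻¹ * Kp⁻¹, ?_⟩
  rw [hΘ₁, hΘ₂, Matrix.transpose_transpose, ← constPoly_mul, Matrix.mul_assoc Kp⁻¹,
    Matrix.nonsing_inv_mul _ hξ.gain_nonsingular, Matrix.mul_one]
  have hS := isUnit_det_toRat (det_charmatrix_ne_zero A)
  have hP := isUnit_det_toRat hZ.1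
  have hGP : transferMatrix A B C * toRat P = toRat Z := by
    rw [hZ.2, Matrix.nonsing_inv_mul_cancel_right _ _ hP]
  have hG₀P : transferMatrix A B C₀ * toRat P = toRat Z₀ := by
    rw [hZ₀.2, Matrix.nonsing_inv_mul_cancel_right _ _ hP]
  have hobsG : toRat (D + Λ • constPoly L) * transferMatrix A B C₀
      + algebraMap ℝ[X] (RatFunc ℝ) Λ • transferMatrix A B (Kp⁻¹ * R)
      = toRat (N * constPoly B) := by
    have h := congrArg
      (fun Q => toRat Q * (toRat A.charmatrix)⁻¹ * toRat (constPoly B)) hobsid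
    simp only [toRat_mul, toRat_smul, toRat_add (_ * _), Matrix.add_mul _ _ (_⁻¹),
      Matrix.add_mul _ _ (toRat (constPoly B)), Matrix.mul_nonsing_inv_cancel_right _ _ hS,
      Matrix.smul_mul] at h
    rw [toRat_mul, ← h]
    simp only [transferMatrix, Matrix.mul_assoc]
  have hgain : toRat (constPoly Kp⁻¹ * ξ) * transferMatrix A B C
      = 1 + transferMatrix A B (Kp⁻¹ * R) := by
    rw [toRat_mul, Matrix.mul_assoc, hR, Matrix.mul_add, ← transferMatrix_mul_left, ← toRat_mul,
      ← constPoly_mul, Matrix.nonsing_inv_mul _ hξ.gain_nonsingular, constPoly_one, toRat_one]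
  have hkey : -toRat (N * constPoly B) + toRat (D + Λ • constPoly L) * transferMatrix A B C₀
      = algebraMap ℝ[X] (RatFunc ℝ) Λ •
        (1 - toRat (constPoly Kp⁻¹ * ξ) * transferMatrix A B C) := by
    rw [hgain, ← hobsG, sub_add_cancel_left, smul_neg]
    abel
  -- With `Z = G P` and `Z₀ = G₀ P`, the claim over rational functions is `hkey` times `P`.
  apply toRat_injective
  rw [toRat_add (_ * _), toRat_mul, toRat_mul _ Z₀, toRat_smul, toRat_sub, toRat_mul _ Z, toRat_neg,
    ← hGP, ← hG₀P, ← Matrix.mul_assoc, ← Matrix.mul_assoc, ← Matrix.add_mul, hkey, Matrix.smul_mul,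
    Matrix.sub_mul, Matrix.one_mul]
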